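/- Let $F$ be a field; all algebras are associative and unital. For an $F$-algebra $R$ with two chosen elements $a,b$, let $I=R(1-ba)$ be the left ideal generated by $1-ba$, write $F+I$ for $F1+I$, and let $$T=\begin{bmatrix} R & I\\ R & F+I\end{bmatrix}\subseteq M_2(R),\qquad Q=\begin{bmatrix} b & 1-ba\\ 0&0\end{bmatrix},\qquad X=\begin{bmatrix} a&0\\ 1&0\end{bmatrix};$$ here $T$ is a unital $F$-subalgebra of $M_2(R)$ containing $Q$ and $X$. 1. Let $S=F\langle q,x\mid qxq=q,\ xqx=x\rangle$ and let $R=F\langle a,b\rangle$ be the free $F$-algebra on $a,b$. Then there is an isomorphism of $F$-algebras $S\cong T$ under which $q\mapsto Q$ and $x\mapsto X$. 2. Let $n\ge 3$, $S=F\langle q,x\mid qxq=q,\ xqx=x,\ x^n=0\rangle$ and $R=F\langle a,b\mid a^{n-1}=0\rangle$. Then there is again an isomorphism of $F$-algebras $S\cong T$ under which $q\mapsto Q$ and $x\mapsto X$. 3. In particular ($n=3$), the algebra $F\langle q,x\mid qxq=q,\ xqx=x,\ x^3=0\rangle$ is isomorphic, via $q\mapsto Q$ and $x\mapsto X$, to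 the Nielsen–Šter algebra, that is, to $T$ for $R=F\langle a,b\mid a^2=0\rangle$. -/

import Mathlib

namespace GenInv

universe u v

/-- The two letters of the free algebra `F⟨q, x⟩`. -/
inductive LetterQX : Type
  | q
  | x

/-- The two letters of the free algebra `F⟨a, b⟩`. -/
inductive LetterAB : Type
  | a
  | b

section Presentations

variable (F : Type u) [Field F]

/-- The defining relations `qxq = q` and `xqx = x` in the free algebra `F⟨q, x⟩`. -/
inductive RelS : FreeAlgebra F LetterQX → FreeAlgebra F LetterQX → Prop
  | qxq : RelS
      (FreeAlgebra.ι F LetterQX.q * FreeAlgebra.ι F LetterQX.x * FreeAlgebra.ι F LetterQX.q)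
      (FreeAlgebra.ι F LetterQX.q)
  | xqx : RelS
      (FreeAlgebra.ι F LetterQX.x * FreeAlgebra.ι F LetterQX.q * FreeAlgebra.ι F LetterQX.x)
      (FreeAlgebra.ι F LetterQX.x)

/-- The relations `qxq = q` and `xqx = x` together with `x ^ n = 0`. -/
inductive RelSNil (n : ℕ) : FreeAlgebra F LetterQX → FreeAlgebra F LetterQX → Prop
  | of {s t : FreeAlgebra F LetterQX} (h : RelS F s t) : RelSNil n s t
  | nil : RelSNil n (FreeAlgebra.ι F LetterQX.x ^ n) 0

/-- The relation `a ^ m = 0` in the free algebra `F⟨a, b⟩`. -/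
inductive RelRNil (m : ℕ) : FreeAlgebra F LetterAB → FreeAlgebra F LetterAB → Prop
  | nil : RelRNil m (FreeAlgebra.ι F LetterAB.a ^ m) 0

/-- The algebra `F⟨q, x | qxq = q, xqx = x⟩`. -/
abbrev S : Type u := RingQuot (RelS F)

/-- The generator `q` of `S F`. -/
def S.q : S F := RingQuot.mkAlgHom F (RelS F) (FreeAlgebra.ι F LetterQX.q)

/-- The generator `x` of `S F`. -/
def S.x : S F := RingQuot.mkAlgHom F (RelS F) (FreeAlgebra.ι F LetterQX.x)

/-- The algebra `F⟨q, x | qxq = q, xqx = x, x ^ n = 0⟩`. -/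
abbrev SNil (n : ℕ) : Type u := RingQuot (RelSNil F n)

/-- The generator `q` of `SNil F n`. -/
def SNil.q (n : ℕ) : SNil F n :=
  RingQuot.mkAlgHom F (RelSNil F n) (FreeAlgebra.ι F LetterQX.q)

/-- The generator `x` of `SNil F n`. -/
def SNil.x (n : ℕ) : SNil F n :=
  RingQuot.mkAlgHom F (RelSNil F n) (FreeAlgebra.ι F LetterQX.x)

/-- The free algebra `F⟨a, b⟩`. -/
abbrev R : Type u := FreeAlgebra F LetterAB

/-- The generator `a` of `R F`. -/
def R.a : R F := FreeAlgebra.ι F LetterAB.a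

/-- The generator `b` of `R F`. -/
def R.b : R F := FreeAlgebra.ι F LetterAB.b

/-- The algebra `F⟨a, b | a ^ m = 0⟩`. -/
abbrev RNil (m : ℕ) : Type u := RingQuot (RelRNil F m)

/-- The generator `a` of `RNil F m`. -/
def RNil.a (m : ℕ) : RNil F m :=
  RingQuot.mkAlgHom F (RelRNil F m) (FreeAlgebra.ι F LetterAB.a)

/-- The generator `b` of `RNil F m`. -/
def RNil.b (m : ℕ) : RNil F m :=
  RingQuot.mkAlgHom F (RelRNil F m) (FreeAlgebra.ι F LetterAB.b)

end Presentations

section MatrixAlgebra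

variable (F : Type u) [Field F] {A : Type v} [Ring A] [Algebra F A]

/-- The left ideal `I = A(1 - ba)` of an algebra `A` with two elements `a`, `b`
(Mathlib's `Ideal` of a noncommutative ring is a left ideal). -/
def leftIdeal (a b : A) : Ideal A := Ideal.span {1 - b * a}

/-- The `F`-subspace `F1 + I`. -/
def scalarsAddIdeal (a b : A) : Submodule F A :=
  Submodule.span F {(1 : A)} ⊔ (leftIdeal a b).restrictScalars F

theorem mem_scalarsAddIdeal {a b y : A} :
    y ∈ scalarsAddIdeal F a b ↔ ∃ c : F, ∃ i ∈ leftIdeal a b, c • (1 : A) + i = y := by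
  simp only [scalarsAddIdeal, Submodule.mem_sup, Submodule.mem_span_singleton,
    Submodule.restrictScalars_mem]
  constructor
  · rintro ⟨_, ⟨c, rfl⟩, i, hi, h⟩
    exact ⟨c, i, hi, h⟩
  · rintro ⟨c, i, hi, h⟩
    exact ⟨_, ⟨c, rfl⟩, i, hi, h⟩

theorem mul_mem_of_mem_scalarsAddIdeal {a b y z : A} (hy : y ∈ leftIdeal a b)
    (hz : z ∈ scalarsAddIdeal F a b) : y * z ∈ leftIdeal a b := by
  obtain ⟨c, i, hi, rfl⟩ := (mem_scalarsAddIdeal F).1 hz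
  rw [mul_add, mul_smul_comm, mul_one]
  refine Ideal.add_mem _ ?_ (Ideal.mul_mem_left _ _ hi)
  rw [Algebra.smul_def]
  exact Ideal.mul_mem_left _ _ hy

theorem mem_scalarsAddIdeal_of_mem {a b y : A} (hy : y ∈ leftIdeal a b) :
    y ∈ scalarsAddIdeal F a b :=
  (mem_scalarsAddIdeal F).2 ⟨0, y, hy, by simp⟩

theorem mul_mem_scalarsAddIdeal {a b y z : A} (hy : y ∈ scalarsAddIdeal F a b)
    (hz : z ∈ scalarsAddIdeal F a b) : y * z ∈ scalarsAddIdeal F a b := by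
  obtain ⟨c, i, hi, rfl⟩ := (mem_scalarsAddIdeal F).1 hy
  rw [add_mul, smul_mul_assoc, one_mul]
  exact Submodule.add_mem _ (Submodule.smul_mem _ c hz)
    (mem_scalarsAddIdeal_of_mem F (mul_mem_of_mem_scalarsAddIdeal F hi hz))

/-- The subalgebra `T` of the algebra of `2 × 2` matrices over `A`, with arbitrary entries in the
first column, entries of `I = A(1 - ba)` in the upper right corner and entries of `F1 + I` in the
lower right corner. -/
def T (a b : A) : Subalgebra F (Matrix (Fin 2) (Fin 2) A) where
  carrier := {M | M 0 1 ∈ leftIdeal a b ∧ M 1 1 ∈ scalarsAddIdeal F a b}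
  mul_mem' := by
    rintro M N ⟨hM, hM'⟩ ⟨hN, hN'⟩
    simp only [Set.mem_ofPred_eq, Matrix.mul_apply, Fin.sum_univ_two]
    exact ⟨Ideal.add_mem _ (Ideal.mul_mem_left _ _ hN) (mul_mem_of_mem_scalarsAddIdeal F hM hN'),
      Submodule.add_mem _ (mem_scalarsAddIdeal_of_mem F (Ideal.mul_mem_left _ _ hN))
        (mul_mem_scalarsAddIdeal F hM' hN')⟩
  add_mem' := by
    rintro M N ⟨hM, hM'⟩ ⟨hN, hN'⟩
    exact ⟨Ideal.add_mem _ hM hN, Submodule.add_mem _ hM' hN'⟩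
  algebraMap_mem' := by
    intro c
    refine ⟨?_, (mem_scalarsAddIdeal F).2 ⟨c, 0, Ideal.zero_mem _, ?_⟩⟩
    · simp [Matrix.algebraMap_matrix_apply]
    · simp [Matrix.algebraMap_matrix_apply, Algebra.smul_def]

/-- The matrix `Q`, with rows `(b, 1 - ba)` and `(0, 0)`. -/
def matQ (a b : A) : Matrix (Fin 2) (Fin 2) A := !![b, 1 - b * a; 0, 0]

/-- The matrix `X`, with rows `(a, 0)` and `(1, 0)`. -/
def matX (a : A) : Matrix (Fin 2) (Fin 2) A := !![a, 0; 1, 0]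

end MatrixAlgebra

end GenInv

namespace GenInv

/-! ### Isomorphism criterion through a Peirce decomposition. -/

section General

variable {F : Type*} [Field F] {B : Type*} [Ring B] [Algebra F B] {A : Type*} [Ring A] [Algebra F A]

open Matrix

/-! Put `e = q * x`, an idempotent with `e * q = q` and `x * e = x`. The elements `e * x * e = q * x
* x` and `e * q * e = q * q * x` play the roles of `a` and `b` in the corner at `e`, which gives `g
: A → B`; the matrices `Q` and `X` give `f : B → M₂(A)`. The sums `peirceSum` contain `1` and are
stable under left multiplication by `q` and `x`, so they exhaust `B` (`exists_eq_peirceSum`). `f`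
sends them to explicit matrices which fill `T` (`map_peirceSum`). Injectivity then needs only that
`1 - b * a` is right regular, shown by a grading, and not left invertible, shown by a representation
on matrix units. -/

theorem matQ_mul_matX (a b : A) : matQ a b * matX a = !![1, 0; 0, 0] := by
  rw [matQ, matX, Matrix.mul_fin_two]; simp

theorem matQ_mul_matX_mul_matQ (a b : A) : matQ a b * matX a * matQ a b = matQ a b := by
  rw [matQ_mul_matX, matQ, Matrix.mul_fin_two]; simp

theorem matX_mul_matQ_mul_matX (a b : A) : matX a * matQ a b * matX a = matX a := by
  rw [mul_assoc, matQ_mul_matX]; simp [matX]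

theorem matX_pow_succ (a : A) (k : ℕ) : matX a ^ (k + 1) = !![a ^ (k + 1), 0; a ^ k, 0] := by
  induction k with
  | zero => simp [matX]
  | succ k ih => rw [pow_succ, ih]; simp [matX, pow_succ]

/-- Explains the shift of exponent: `x ^ n = 0` forces the corner element `q * x * x` to have `(n -
1)`-st power zero. -/
theorem mul_mul_pow_of_mul_mul_eq {q x : B} (hx : x * q * x = x) (k : ℕ) :
    (q * x * x) ^ (k + 1) = q * x ^ (k + 2) := by
  induction k with
  | zero => rw [pow_one, zero_add, pow_two, mul_assoc]
  | succ k ih =>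
    rw [pow_succ, ih, pow_succ x (k + 1), pow_succ x (k + 2), pow_succ x (k + 1)]
    calc q * (x ^ (k + 1) * x) * (q * x * x) = q * x ^ (k + 1) * (x * q * x) * x := by noncomm_ring
      _ = _ := by rw [hx]; noncomm_ring

/-- The element of `B` with the given Peirce components relative to the idempotent `q * x`. -/
def peirceSum (q x : B) (g : A →ₐ[F] B) (r₀ r₁ r₂ r₃ : A) (c : F) : B :=
  q * x * g r₀ + q * x * g r₁ * (q * (1 - q * x)) + (1 - q * x) * x * g r₂ +
    c • (1 - q * x) + (1 - q * x) * x * g r₃ * (q * (1 - q * x))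

variable {q x : B} {a b : A} {g : A →ₐ[F] B}

/-- The lower row vanishes because `q = e * q`; the factor `1 - b * a` comes from `q * (1 - e) * x =
e * g (1 - b * a)`. -/
theorem mul_left_q_peirceSum (hq : q * x * q = q) (hx : x * q * x = x)
    (ha : g a = q * x * x) (hb : g b = q * q * x) (r₀ r₁ r₂ r₃ : A) (c : F) :
    q * peirceSum q x g r₀ r₁ r₂ r₃ c =
      peirceSum q x g (b * r₀ + (1 - b * a) * r₂) (b * r₁ + algebraMap F A c + (1 - b * a) * r₃)
        0 0 0 := by
  have h1 : q * x * g b = q * (q * x) := by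
    rw [hb]
    calc q * x * (q * q * x) = (q * x * q) * q * x := by noncomm_ring
      _ = _ := by rw [hq]; noncomm_ring
  have h2 : q * x * g (1 - b * a) = q * ((1 - q * x) * x) := by
    rw [map_sub, map_one, map_mul, ha, hb]
    calc q * x * (1 - q * q * x * (q * x * x))
        = q * x - (q * x * q) * q * (x * q * x) * x := by noncomm_ring
      _ = _ := by rw [hq, hx]; noncomm_ring
  have h3 : q * x * g (algebraMap F A c) * (q * (1 - q * x)) = c • (q * (1 - q * x)) := by
    rw [AlgHom.commutes, ← Algebra.commutes, ← Algebra.smul_def, smul_mul_assoc, ← mul_assoc, hq]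
  simp only [peirceSum, map_zero, mul_zero, zero_mul, zero_smul, add_zero, map_add, mul_add,
    add_mul, h3]
  simp only [map_mul g, ← mul_assoc (q * x), h1, h2]
  simp only [mul_smul_comm]
  noncomm_ring

/-- Since `x * (1 - e) = 0`, only the upper row survives, and `x * e = e * g a + (1 - e) * x` splits
it between the two rows. -/
theorem mul_left_x_peirceSum (hq : q * x * q = q) (hx : x * q * x = x)
    (ha : g a = q * x * x) (r₀ r₁ r₂ r₃ : A) (c : F) :
    x * peirceSum q x g r₀ r₁ r₂ r₃ c = peirceSum q x g (a * r₀) (a * r₁) r₀ r₁ 0 := by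
  have h1 : q * x * g a + (1 - q * x) * x = x * (q * x) := by
    rw [ha]
    calc q * x * (q * x * x) + (1 - q * x) * x = (q * x * q) * x * x + x - q * x * x := by
          noncomm_ring
      _ = x * q * x := by rw [hq, hx]; abel
      _ = _ := mul_assoc _ _ _
  have h2 : x * (1 - q * x) = 0 := by rw [mul_sub, ← mul_assoc, hx, mul_one, sub_self]
  calc x * peirceSum q x g r₀ r₁ r₂ r₃ c
      = x * (q * x) * g r₀ + x * (q * x) * g r₁ * (q * (1 - q * x)) +
        x * (1 - q * x) * (x * g r₂) + c • (x * (1 - q * x)) +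
        x * (1 - q * x) * (x * g r₃ * (q * (1 - q * x))) := by
          simp only [peirceSum, mul_add, mul_smul_comm, mul_assoc]
    _ = _ := by
          rw [h2, ← h1]
          simp only [peirceSum, map_mul, zero_mul, smul_zero, add_zero, zero_smul]
          noncomm_ring

theorem exists_eq_peirceSum (hq : q * x * q = q) (hx : x * q * x = x)
    (hB : Algebra.adjoin F {q, x} = ⊤)
    (ha : g a = q * x * x) (hb : g b = q * q * x) (s : B) :
    ∃ r₀ r₁ r₂ r₃ c, s = peirceSum q x g r₀ r₁ r₂ r₃ c := by
  have key : ∀ t : B, ∀ r₀ r₁ r₂ r₃ c, ∃ r₀' r₁' r₂' r₃' c',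
      t * peirceSum q x g r₀ r₁ r₂ r₃ c = peirceSum q x g r₀' r₁' r₂' r₃' c' := by
    intro t
    have ht : t ∈ Algebra.adjoin F {q, x} := hB ▸ Algebra.mem_top
    induction ht using Algebra.adjoin_induction with
    | mem t ht =>
      intro r₀ r₁ r₂ r₃ c
      rcases ht with rfl | rfl
      · exact ⟨_, _, _, _, _, mul_left_q_peirceSum hq hx ha hb r₀ r₁ r₂ r₃ c⟩
      · exact ⟨_, _, _, _, _, mul_left_x_peirceSum hq hx ha r₀ r₁ r₂ r₃ c⟩
    | algebraMap k =>
      intro r₀ r₁ r₂ r₃ c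
      refine ⟨k • r₀, k • r₁, k • r₂, k • r₃, k * c, ?_⟩
      simp only [← Algebra.smul_def, peirceSum, map_smul, smul_add, mul_smul_comm, smul_mul_assoc,
        mul_smul]
    | add t u _ _ ht hu =>
      intro r₀ r₁ r₂ r₃ c
      obtain ⟨s₀, s₁, s₂, s₃, d, hs⟩ := ht r₀ r₁ r₂ r₃ c
      obtain ⟨t₀, t₁, t₂, t₃, d', ht⟩ := hu r₀ r₁ r₂ r₃ c
      refine ⟨s₀ + t₀, s₁ + t₁, s₂ + t₂, s₃ + t₃, d + d', ?_⟩
      rw [add_mul, hs, ht]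
      simp only [peirceSum, map_add, mul_add, add_mul, add_smul]
      abel
    | mul t u _ _ ht hu =>
      intro r₀ r₁ r₂ r₃ c
      obtain ⟨s₀, s₁, s₂, s₃, d, hs⟩ := hu r₀ r₁ r₂ r₃ c
      rw [mul_assoc, hs]
      exact ht _ _ _ _ _
  have h1 : peirceSum q x g 1 0 0 0 1 = 1 := by simp [peirceSum]
  simpa [h1] using key s 1 0 0 0 1

variable {f : B →ₐ[F] Matrix (Fin 2) (Fin 2) A}

/-- The remaining diagonal entry is irrelevant: in `peirceSum` every `g r` is preceded by `e` or `(1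
- e) * x`, whose images have zero second column. -/
theorem apply_comp_entries (hfq : f q = matQ a b) (hfx : f x = matX a)
    (hA : Algebra.adjoin F {a, b} = ⊤) (ha : g a = q * x * x) (hb : g b = q * q * x) (r : A) :
    f (g r) 0 0 = r ∧ f (g r) 0 1 = 0 ∧ f (g r) 1 0 = 0 := by
  have hr : r ∈ Algebra.adjoin F {a, b} := hA ▸ Algebra.mem_top
  induction hr using Algebra.adjoin_induction with
  | mem r hr =>
    rcases hr with rfl | rfl
    · rw [ha, map_mul, map_mul, hfq, hfx, matQ_mul_matX]; simp [matX]
    · rw [hb, mul_assoc, map_mul, map_mul, hfq, hfx, matQ_mul_matX]; simp [matQ]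
  | algebraMap c => simp [Matrix.algebraMap_matrix_apply]
  | add r s _ _ hr hs => simp [hr, hs]
  | mul r s _ _ hr hs => simp [Matrix.mul_apply, hr, hs]

theorem map_peirceSum (hfq : f q = matQ a b) (hfx : f x = matX a)
    (hA : Algebra.adjoin F {a, b} = ⊤) (ha : g a = q * x * x) (hb : g b = q * q * x)
    (r₀ r₁ r₂ r₃ : A) (c : F) :
    f (peirceSum q x g r₀ r₁ r₂ r₃ c) =
      !![r₀, r₁ * (1 - b * a); r₂, c • 1 + r₃ * (1 - b * a)] := by
  have h (r) := apply_comp_entries hfq hfx hA ha hb r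
  have hE : (1 : Matrix (Fin 2) (Fin 2) A) - !![1, 0; 0, 0] = !![0, 0; 0, 1] := by
    ext i j; fin_cases i <;> fin_cases j <;> simp
  have hY : matQ a b * !![0, 0; 0, 1] = !![0, 1 - b * a; 0, 0] := by
    rw [matQ, Matrix.mul_fin_two]; simp
  have hZ : !![0, 0; 0, 1] * matX a = !![0, 0; 1, 0] := by
    rw [matX, Matrix.mul_fin_two]; simp
  have hg (r) : f (g r) = !![r, 0; 0, f (g r) 1 1] := by
    rw [Matrix.eta_fin_two (f (g r)), (h r).1, (h r).2.1, (h r).2.2]; simp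
  simp only [peirceSum, map_add, map_mul, map_sub, map_one, map_smul, hfq, hfx, matQ_mul_matX, hE,
    hY, hZ]
  rw [hg r₀, hg r₁, hg r₂, hg r₃]
  simp [Matrix.smul_of]

theorem exists_algEquiv_T (hq : q * x * q = q) (hx : x * q * x = x)
    (hB : Algebra.adjoin F {q, x} = ⊤) (hfq : f q = matQ a b) (hfx : f x = matX a)
    (hA : Algebra.adjoin F {a, b} = ⊤) (ha : g a = q * x * x) (hb : g b = q * q * x)
    (hreg : ∀ r : A, r * (1 - b * a) = 0 → r = 0) (hone : ∀ r : A, r * (1 - b * a) ≠ 1) :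
    ∃ e : B ≃ₐ[F] T F a b, (e q : Matrix (Fin 2) (Fin 2) A) = matQ a b ∧
      (e x : Matrix (Fin 2) (Fin 2) A) = matX a := by
  have hf := map_peirceSum hfq hfx hA ha hb
  have hspan := exists_eq_peirceSum hq hx hB ha hb
  have hinj : Function.Injective f := by
    rw [injective_iff_map_eq_zero]
    intro s hs
    obtain ⟨r₀, r₁, r₂, r₃, c, rfl⟩ := hspan s
    rw [hf] at hs
    have h00 : r₀ = 0 := by simpa using congrFun (congrFun hs 0) 0
    have h01 : r₁ * (1 - b * a) = 0 := by simpa using congrFun (congrFun hs 0) 1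
    have h10 : r₂ = 0 := by simpa using congrFun (congrFun hs 1) 0
    have h11 : c • (1 : A) + r₃ * (1 - b * a) = 0 := by simpa using congrFun (congrFun hs 1) 1
    -- If `c ≠ 0`, dividing by `-c` would make `1 - b * a` left invertible.
    have hc0 : c = 0 := by
      by_contra hc0
      refine hone (-(c⁻¹ • r₃)) ?_
      rw [neg_mul, smul_mul_assoc, eq_neg_of_add_eq_zero_right h11, smul_neg, neg_neg,
        inv_smul_smul₀ hc0]
    subst hc0
    have h3 := hreg r₃ (by simpa using h11)
    simp [h00, hreg r₁ h01, h10, h3, peirceSum]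
  have hrange : f.range = T F a b := by
    ext M
    constructor
    · rintro ⟨s, rfl⟩
      obtain ⟨r₀, r₁, r₂, r₃, c, rfl⟩ := hspan s
      change f _ ∈ T F a b
      rw [hf]
      refine ⟨?_, (mem_scalarsAddIdeal F).2 ⟨c, r₃ * (1 - b * a), ?_, ?_⟩⟩
      · exact Ideal.mem_span_singleton'.2 ⟨r₁, by simp⟩
      · exact Ideal.mem_span_singleton'.2 ⟨r₃, rfl⟩
      · simp
    · rintro ⟨h01, h11⟩
      obtain ⟨r₁, h01⟩ := Ideal.mem_span_singleton'.1 h01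
      obtain ⟨c, i, hi, h11⟩ := (mem_scalarsAddIdeal F).1 h11
      obtain ⟨r₃, rfl⟩ := Ideal.mem_span_singleton'.1 hi
      refine ⟨peirceSum q x g (M 0 0) r₁ (M 1 0) r₃ c, ?_⟩
      change f _ = M
      rw [hf, h01, h11]
      exact (Matrix.eta_fin_two M).symm
  exact ⟨(AlgEquiv.ofInjective f hinj).trans (Subalgebra.equivOfEq _ _ hrange), hfq, hfx⟩

/-! ### The two conditions on `1 - b * a`. -/

open Polynomial in
/-- An element `1 - b * a` is right regular as soon as `a` and `b` can be made homogeneous of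
degree one. -/
theorem eq_zero_of_mul_one_sub_eq_zero (hA : Algebra.adjoin F {a, b} = ⊤) (ρ : A →ₐ[F] A[X])
    (ha : ρ a = C a * X) (hb : ρ b = C b * X) (r : A) (h : r * (1 - b * a) = 0) : r = 0 := by
  have hp : ρ r = ρ r * C (b * a) * X ^ 2 := by
    have := congrArg ρ h
    rw [map_mul, map_sub, map_mul, map_one, map_zero, ha, hb, mul_sub, mul_one, sub_eq_zero] at this
    have hX : C b * X * (C a * X) = C (b * a) * (X ^ 2 : A[X]) := by
      rw [C_mul, pow_two, mul_assoc, ← mul_assoc X, X_mul_C]; simp only [mul_assoc]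
    rwa [hX, ← mul_assoc] at this
  -- By `hp`, each coefficient is a multiple of the one two degrees lower.
  have h0 : ρ r = 0 := by
    ext k
    induction k using Nat.strong_induction_on with
    | _ k ih =>
      rw [hp, coeff_mul_X_pow']
      split_ifs with hk
      · rw [coeff_mul_C, ih _ (by omega)]; simp
      · simp
  -- Setting `X = 1` undoes the grading, so `ρ` is injective.
  have heval : ∀ s : A, (ρ s).eval 1 = s := by
    intro s
    have hs : s ∈ Algebra.adjoin F {a, b} := hA ▸ Algebra.mem_top
    induction hs using Algebra.adjoin_induction with
    | mem s hs => rcases hs with rfl | rfl <;> simp [ha, hb]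
    | algebraMap c => rw [AlgHom.commutes]; simp [Polynomial.algebraMap_apply]
    | add s t _ _ hs ht => rw [map_add, eval_add, hs, ht]
    | mul s t _ _ hs ht =>
      rw [map_mul, eval, eval₂_mul_noncomm _ _ fun _ => Commute.one_right _, ← eval, hs, ← eval, ht]
  rw [← heval r, h0, eval_zero]

/-- If `a` and `b` act by matrix units, then `1 - b * a` is not left invertible. -/
theorem mul_one_sub_ne_one (σ : A →ₐ[F] Matrix (Fin 2) (Fin 2) F) (ha : σ a = !![0, 1; 0, 0])
    (hb : σ b = !![0, 0; 1, 0]) (r : A) : r * (1 - b * a) ≠ 1 := by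
  intro h
  -- `1 - b * a` maps to a matrix with zero second column, so this entry reads `0 = 1`.
  have h := congrFun (congrFun (congrArg σ h) 1) 1
  rw [map_mul, map_sub, map_mul, ha, hb] at h
  simp [Matrix.mul_apply] at h

end General

/-! ### Generators and universal properties of the presented algebras. -/

section Presentations

variable (F : Type*) [Field F]

/-- The map on the letters `q`, `x` with the given values. -/
def LetterQX.elim {α : Type*} (u v : α) : LetterQX → α
  | .q => u
  | .x => v

/-- The map on the letters `a`, `b` with the given values. -/
def LetterAB.elim {α : Type*} (u v : α) : LetterAB → α
  | .a => u
  | .b => v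

theorem adjoin_q_x_eq_top {rel : FreeAlgebra F LetterQX → FreeAlgebra F LetterQX → Prop} :
    Algebra.adjoin F {RingQuot.mkAlgHom F rel (FreeAlgebra.ι F LetterQX.q),
      RingQuot.mkAlgHom F rel (FreeAlgebra.ι F LetterQX.x)} = ⊤ := by
  have h : Set.range (FreeAlgebra.ι F (X := LetterQX)) =
      {FreeAlgebra.ι F LetterQX.q, FreeAlgebra.ι F LetterQX.x} := by
    ext y
    constructor
    · rintro ⟨_ | _, rfl⟩ <;> simp
    · rintro (rfl | rfl) <;> exact ⟨_, rfl⟩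
  rw [← Set.image_pair, ← AlgHom.map_adjoin, ← h, FreeAlgebra.adjoin_range_ι, Algebra.map_top,
    AlgHom.range_eq_top]
  exact RingQuot.mkAlgHom_surjective F rel

theorem adjoin_ι_a_b_eq_top :
    Algebra.adjoin F {FreeAlgebra.ι F LetterAB.a, FreeAlgebra.ι F LetterAB.b} = ⊤ := by
  rw [← FreeAlgebra.adjoin_range_ι]
  congr 1
  ext y
  constructor
  · rintro (rfl | rfl) <;> exact ⟨_, rfl⟩
  · rintro ⟨_ | _, rfl⟩ <;> simp

theorem adjoin_a_b_eq_top (m : ℕ) : Algebra.adjoin F {RNil.a F m, RNil.b F m} = ⊤ := by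
  rw [RNil.a, RNil.b, ← Set.image_pair, ← AlgHom.map_adjoin, adjoin_ι_a_b_eq_top, Algebra.map_top,
    AlgHom.range_eq_top]
  exact RingQuot.mkAlgHom_surjective F _

theorem S.qxq : S.q F * S.x F * S.q F = S.q F := by
  simpa [S.q, S.x] using RingQuot.mkAlgHom_rel F (RelS.qxq (F := F))

theorem S.xqx : S.x F * S.q F * S.x F = S.x F := by
  simpa [S.q, S.x] using RingQuot.mkAlgHom_rel F (RelS.xqx (F := F))

theorem SNil.qxq (n : ℕ) : SNil.q F n * SNil.x F n * SNil.q F n = SNil.q F n := by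
  simpa [SNil.q, SNil.x] using RingQuot.mkAlgHom_rel F (RelSNil.of (n := n) (RelS.qxq (F := F)))

theorem SNil.xqx (n : ℕ) : SNil.x F n * SNil.q F n * SNil.x F n = SNil.x F n := by
  simpa [SNil.q, SNil.x] using RingQuot.mkAlgHom_rel F (RelSNil.of (n := n) (RelS.xqx (F := F)))

theorem SNil.x_pow (n : ℕ) : SNil.x F n ^ n = 0 := by
  simpa [SNil.x] using RingQuot.mkAlgHom_rel F (RelSNil.nil (F := F) (n := n))

theorem RNil.a_pow (m : ℕ) : RNil.a F m ^ m = 0 := by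
  simpa [RNil.a] using RingQuot.mkAlgHom_rel F (RelRNil.nil (F := F) (m := m))

variable {C : Type*} [Ring C] [Algebra F C]

theorem S.exists_lift {u v : C} (hu : u * v * u = u) (hv : v * u * v = v) :
    ∃ f : S F →ₐ[F] C, f (S.q F) = u ∧ f (S.x F) = v := by
  refine ⟨RingQuot.liftAlgHom F ⟨FreeAlgebra.lift F (LetterQX.elim u v), ?_⟩, ?_, ?_⟩
  · rintro _ _ (_ | _) <;> simpa [LetterQX.elim]
  · simp [S.q, LetterQX.elim]
  · simp [S.x, LetterQX.elim]

theorem SNil.exists_lift {n : ℕ} {u v : C} (hu : u * v * u = u) (hv : v * u * v = v)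
    (hn : v ^ n = 0) : ∃ f : SNil F n →ₐ[F] C, f (SNil.q F n) = u ∧ f (SNil.x F n) = v := by
  refine ⟨RingQuot.liftAlgHom F ⟨FreeAlgebra.lift F (LetterQX.elim u v), ?_⟩, ?_, ?_⟩
  · rintro _ _ ((_ | _) | _) <;> simpa [LetterQX.elim]
  · simp [SNil.q, LetterQX.elim]
  · simp [SNil.x, LetterQX.elim]

theorem R.exists_lift (u v : C) : ∃ f : R F →ₐ[F] C, f (R.a F) = u ∧ f (R.b F) = v :=
  ⟨FreeAlgebra.lift F (LetterAB.elim u v), by simp [R.a, LetterAB.elim],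
    by simp [R.b, LetterAB.elim]⟩

theorem RNil.exists_lift {m : ℕ} {u : C} (v : C) (hu : u ^ m = 0) :
    ∃ f : RNil F m →ₐ[F] C, f (RNil.a F m) = u ∧ f (RNil.b F m) = v := by
  refine ⟨RingQuot.liftAlgHom F ⟨FreeAlgebra.lift F (LetterAB.elim u v), ?_⟩, ?_, ?_⟩
  · rintro _ _ ⟨⟩; simpa [LetterAB.elim]
  · simp [RNil.a, LetterAB.elim]
  · simp [RNil.b, LetterAB.elim]

/-! ### The isomorphisms. -/

theorem exists_algEquiv_S : ∃ e : S F ≃ₐ[F] T F (R.a F) (R.b F),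
    (e (S.q F) : Matrix (Fin 2) (Fin 2) (R F)) = matQ (R.a F) (R.b F) ∧
      (e (S.x F) : Matrix (Fin 2) (Fin 2) (R F)) = matX (R.a F) := by
  obtain ⟨f, hfq, hfx⟩ := S.exists_lift F (matQ_mul_matX_mul_matQ (R.a F) (R.b F))
    (matX_mul_matQ_mul_matX (R.a F) (R.b F))
  obtain ⟨g, ha, hb⟩ := R.exists_lift F (S.q F * S.x F * S.x F) (S.q F * S.q F * S.x F)
  obtain ⟨ρ, hρa, hρb⟩ := R.exists_lift F (Polynomial.C (R.a F) * Polynomial.X)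
    (Polynomial.C (R.b F) * Polynomial.X)
  obtain ⟨σ, hσa, hσb⟩ := R.exists_lift F (!![0, 1; 0, 0] : Matrix (Fin 2) (Fin 2) F)
    !![0, 0; 1, 0]
  exact exists_algEquiv_T (S.qxq F) (S.xqx F) (adjoin_q_x_eq_top F) hfq hfx (adjoin_ι_a_b_eq_top F)
    ha hb (eq_zero_of_mul_one_sub_eq_zero (adjoin_ι_a_b_eq_top F) ρ hρa hρb)
    (mul_one_sub_ne_one σ hσa hσb)

theorem exists_algEquiv_SNil (m : ℕ) (hm : 2 ≤ m) :
    ∃ e : SNil F (m + 1) ≃ₐ[F] T F (RNil.a F m) (RNil.b F m),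
      (e (SNil.q F (m + 1)) : Matrix (Fin 2) (Fin 2) (RNil F m)) =
          matQ (RNil.a F m) (RNil.b F m) ∧
        (e (SNil.x F (m + 1)) : Matrix (Fin 2) (Fin 2) (RNil F m)) = matX (RNil.a F m) := by
  obtain ⟨k, rfl⟩ := Nat.exists_eq_add_of_le' hm
  have hX : matX (RNil.a F (k + 2)) ^ (k + 2 + 1) = 0 := by
    rw [matX_pow_succ, pow_succ, RNil.a_pow, zero_mul]
    ext i j; fin_cases i <;> fin_cases j <;> rfl
  obtain ⟨f, hfq, hfx⟩ := SNil.exists_lift F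
    (matQ_mul_matX_mul_matQ (RNil.a F (k + 2)) (RNil.b F (k + 2)))
    (matX_mul_matQ_mul_matX (RNil.a F (k + 2)) (RNil.b F (k + 2))) hX
  obtain ⟨g, ha, hb⟩ := RNil.exists_lift F (m := k + 2)
    (u := SNil.q F (k + 2 + 1) * SNil.x F (k + 2 + 1) * SNil.x F (k + 2 + 1))
    (SNil.q F (k + 2 + 1) * SNil.q F (k + 2 + 1) * SNil.x F (k + 2 + 1))
    (by rw [mul_mul_pow_of_mul_mul_eq (SNil.xqx F _), SNil.x_pow, mul_zero])
  obtain ⟨ρ, hρa, hρb⟩ := RNil.exists_lift F (m := k + 2)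
    (u := Polynomial.C (RNil.a F (k + 2)) * Polynomial.X)
    (Polynomial.C (RNil.b F (k + 2)) * Polynomial.X) (by
      rw [Commute.mul_pow (Polynomial.X_mul_C _).symm, ← Polynomial.C_pow, RNil.a_pow, map_zero, zero_mul])
  -- The matrix unit squares to zero, so `2 ≤ m` suffices; for `m = 1` one has `a = 0` and `1 - b *
  -- a = 1`.
  obtain ⟨σ, hσa, hσb⟩ := RNil.exists_lift F (m := k + 2)
    (u := (!![0, 1; 0, 0] : Matrix (Fin 2) (Fin 2) F)) !![0, 0; 1, 0] (by
      rw [pow_add, pow_two, Matrix.mul_fin_two]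
      convert mul_zero _
      ext i j; fin_cases i <;> fin_cases j <;> simp)
  exact exists_algEquiv_T (SNil.qxq F _) (SNil.xqx F _) (adjoin_q_x_eq_top F) hfq hfx
    (adjoin_a_b_eq_top F _) ha hb
    (eq_zero_of_mul_one_sub_eq_zero (adjoin_a_b_eq_top F _) ρ hρa hρb)
    (mul_one_sub_ne_one σ hσa hσb)

end Presentations

end GenInv


theorem proposition3p1 (F : Type*) [Field F] :
    (∃ e : GenInv.S F ≃ₐ[F] GenInv.T F (GenInv.R.a F) (GenInv.R.b F),
      (e (GenInv.S.q F) : Matrix (Fin 2) (Fin 2) (GenInv.R F)) =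
          GenInv.matQ (GenInv.R.a F) (GenInv.R.b F) ∧
        (e (GenInv.S.x F) : Matrix (Fin 2) (Fin 2) (GenInv.R F)) =
          GenInv.matX (GenInv.R.a F)) ∧
    (∀ n : ℕ, 3 ≤ n →
      ∃ e : GenInv.SNil F n ≃ₐ[F]
          GenInv.T F (GenInv.RNil.a F (n - 1)) (GenInv.RNil.b F (n - 1)),
        (e (GenInv.SNil.q F n) : Matrix (Fin 2) (Fin 2) (GenInv.RNil F (n - 1))) =
            GenInv.matQ (GenInv.RNil.a F (n - 1)) (GenInv.RNil.b F (n - 1)) ∧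
          (e (GenInv.SNil.x F n) : Matrix (Fin 2) (Fin 2) (GenInv.RNil F (n - 1))) =
            GenInv.matX (GenInv.RNil.a F (n - 1))) ∧
    (∃ e : GenInv.SNil F 3 ≃ₐ[F] GenInv.T F (GenInv.RNil.a F 2) (GenInv.RNil.b F 2),
      (e (GenInv.SNil.q F 3) : Matrix (Fin 2) (Fin 2) (GenInv.RNil F 2)) =
          GenInv.matQ (GenInv.RNil.a F 2) (GenInv.RNil.b F 2) ∧
        (e (GenInv.SNil.x F 3) : Matrix (Fin 2) (Fin 2) (GenInv.RNil F 2)) =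
          GenInv.matX (GenInv.RNil.a F 2)) := by
  refine ⟨GenInv.exists_algEquiv_S F, fun n hn => ?_, GenInv.exists_algEquiv_SNil F 2 le_rfl⟩
  obtain ⟨k, rfl⟩ := Nat.exists_eq_add_of_le' hn
  exact GenInv.exists_algEquiv_SNil F (k + 2) (by omega)
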